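/- Let $\mathcal{A}$ be a real central hyperplane arrangement, that is, a finite set of linear hyperplanes in a finite-dimensional real vector space $V$. Its chambers are the connected components of $V\setminus\bigcup_{H\in\mathcal{A}}H$, and its tope graph $\mathcal{T}(\mathcal{A})$ has the chambers as vertices, two chambers being adjacent if exactly one hyperplane of $\mathcal{A}$ separates them. Let $d$ be the shortest-path distance of $\mathcal{T}(\mathcal{A})$, let $Z=[q^{d(C,D)}]_{C,D}$, an invertible matrix over $\mathbb{Q}(q)$, and define the magnitude $\mathrm{Mag}(\mathcal{A})=\mathrm{Mag}(\mathcal{A},q)\in\mathbb{Q}(q)$ to be the sum of all entries of $Z^{-1}$. Let $\operatorname{rank}\mathcal{A}=\operatorname{codim}\bigcap_{H\in\mathcal{A}}H$ and define the interior magnitude by $\mathrm{Mag}^{\circ}(\mathcal{A},q)=(-1)^{\operatorname{rank}\mathcal{A}}\,\mathrm{Mag}(\mathcal{A},q^{-1})$. Let $\mathcal{F}(\mathcal{A})$ be the finite set of faces (covectors) of $\mathcal{A}$, i.e. the nonempty subsets of $V$ on which the sign vector with respect to the hyperplanes of $\mathcal{A}$ takes a fixed value. For a face $F$ let $\operatorname{codim}F$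 be the codimension of the linear span of $F$, and let $\mathcal{A}_F=\{H\in\mathcal{A}\mid F\subseteq H\}$. Then \[ \mathrm{Mag}(\mathcal{A})=\sum_{F\in\mathcal{F}(\mathcal{A})}\mathrm{Mag}^{\circ}(\mathcal{A}_F)=\sum_{F\in\mathcal{F}(\mathcal{A})}(-1)^{\operatorname{codim}F}\,q^{\#\mathcal{A}_F}\,\mathrm{Mag}(\mathcal{A}_F). \] -/

import Mathlib

noncomputable section

namespace SimpleGraph

open Classical in
/-- The zeta matrix `[q ^ d(x, y)]` of a graph over `ℚ(q)`, where `d` is the shortest-path distance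
and `q ^ ∞ = 0`. -/
def zetaMatrix {V : Type*} (G : SimpleGraph V) : Matrix V V (RatFunc ℚ) :=
  Matrix.of fun x y => if G.Reachable x y then RatFunc.X ^ G.dist x y else 0

open Classical in
/-- The magnitude of a finite graph: the sum of all entries of the inverse of its zeta matrix. -/
def magnitude {V : Type*} [Fintype V] (G : SimpleGraph V) : RatFunc ℚ :=
  ∑ x, ∑ y, (G.zetaMatrix)⁻¹ x y

open Classical in
/-- The zeta matrix of a finite graph is invertible, so the inverse in `magnitude` is a genuine
inverse. -/
theorem isUnit_det_zetaMatrix {V : Type*} [Fintype V] (G : SimpleGraph V) :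
    IsUnit G.zetaMatrix.det := by
  let M : Matrix V V (Polynomial ℚ) :=
    Matrix.of fun x y => if G.Reachable x y then Polynomial.X ^ G.dist x y else 0
  have h1 : G.zetaMatrix = (algebraMap (Polynomial ℚ) (RatFunc ℚ)).mapMatrix M := by
    ext x y
    by_cases h : G.Reachable x y <;> simp [zetaMatrix, M, h]
  have h2 : (Polynomial.evalRingHom (0 : ℚ)).mapMatrix M = 1 := by
    ext x y
    by_cases hxy : x = y
    · subst hxy
      simp [M]
    · by_cases h : G.Reachable x y
      · have : G.dist x y ≠ 0 := (h.pos_dist_of_ne hxy).ne'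
        simp [M, h, hxy, this]
      · simp [M, h, hxy]
  have h3 : M.det ≠ 0 := by
    intro h0
    have := RingHom.map_det (Polynomial.evalRingHom (0 : ℚ)) M
    rw [h2, h0] at this
    simp at this
  rw [h1, ← RingHom.map_det, isUnit_iff_ne_zero]
  simpa using h3

end SimpleGraph

/-- A real central hyperplane arrangement: a finite set of linear hyperplanes of `V`. -/
structure CentralArrangement (V : Type*) [AddCommGroup V] [Module ℝ V] where
  /-- The hyperplanes. -/
  hyperplanes : Finset (Submodule ℝ V)
  /-- Each member has codimension one. -/
  codim_one : ∀ H ∈ hyperplanes, Module.finrank ℝ (V ⧸ H) = 1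

namespace CentralArrangement

section Linear

variable {V : Type*} [AddCommGroup V] [Module ℝ V]

/-- The stratum of `x`: the points having the same sign vector as `x`. Two defining forms of a
hyperplane differ by a nonzero scalar, so it is harmless to quantify over all of them. -/
def stratum (A : CentralArrangement V) (x : V) : Set V :=
  {y | ∀ H ∈ A.hyperplanes, ∀ α : Module.Dual ℝ V, LinearMap.ker α = H →
    SignType.sign (α y) = SignType.sign (α x)}

/-- The faces (covectors) of the arrangement: its strata, as subsets of `V`. -/
def faces (A : CentralArrangement V) : Set (Set V) :=
  Set.range A.stratum

/-- The codimension of a set, that is, of the smallest linear subspace containing it. -/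
def codim (F : Set V) : ℕ :=
  Module.finrank ℝ (V ⧸ Submodule.span ℝ F)

/-- The rank of an arrangement: the codimension of the intersection of its hyperplanes. -/
def rank (A : CentralArrangement V) : ℕ :=
  Module.finrank ℝ (V ⧸ (⨅ H ∈ A.hyperplanes, H))

open Classical in
/-- The localization `A_F`: the subarrangement of the hyperplanes that contain `F`. -/
def localization (A : CentralArrangement V) (F : Set V) : CentralArrangement V where
  hyperplanes := A.hyperplanes.filter fun H => F ⊆ (H : Set V)
  codim_one H hH := A.codim_one H (Finset.mem_filter.mp hH).1

/-- The complement of the union of the hyperplanes. -/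
def complement (A : CentralArrangement V) : Set V :=
  {x | ∀ H ∈ A.hyperplanes, x ∉ H}

/-- `H` separates `C` and `D`: these lie in opposite open half-spaces bounded by `H`. -/
def Separates (H : Submodule ℝ V) (C D : Set V) : Prop :=
  ∃ α : Module.Dual ℝ V, LinearMap.ker α = H ∧ (∀ x ∈ C, 0 < α x) ∧ ∀ y ∈ D, α y < 0

open Classical in
/-- The set `S(C, D)` of the hyperplanes of the arrangement that separate `C` and `D`. -/
def separating (A : CentralArrangement V) (C D : Set V) : Finset (Submodule ℝ V) :=
  A.hyperplanes.filter fun H => Separates H C D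

theorem mem_separating {A : CentralArrangement V} {C D : Set V} {H : Submodule ℝ V} :
    H ∈ A.separating C D ↔ H ∈ A.hyperplanes ∧ Separates H C D := by
  simp [separating]

theorem Separates.symm {H : Submodule ℝ V} {C D : Set V} (h : Separates H C D) :
    Separates H D C := by
  obtain ⟨α, hα, hC, hD⟩ := h
  refine ⟨-α, ?_, fun x hx => ?_, fun y hy => ?_⟩
  · rw [← hα]
    ext x
    simp
  · simpa using hD x hx
  · simpa using hC y hy

theorem exists_form {H : Submodule ℝ V} (hH : Module.finrank ℝ (V ⧸ H) = 1) :
    ∃ α : Module.Dual ℝ V, LinearMap.ker α = H := by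
  have : FiniteDimensional ℝ (V ⧸ H) := Module.finite_of_finrank_pos (by omega)
  let e : (V ⧸ H) ≃ₗ[ℝ] ℝ := LinearEquiv.ofFinrankEq _ _ (by simpa using hH)
  exact ⟨e.toLinearMap ∘ₗ H.mkQ, by rw [LinearEquiv.ker_comp, Submodule.ker_mkQ]⟩

theorem exists_eq_smul {α β : Module.Dual ℝ V} (h : LinearMap.ker α = LinearMap.ker β) :
    ∃ c : ℝ, β = c • α := by
  by_cases h0 : α = 0
  · refine ⟨0, ?_⟩
    rw [h0, LinearMap.ker_zero] at h
    rw [zero_smul]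
    exact LinearMap.ker_eq_top.mp h.symm
  · obtain ⟨v, hv⟩ : ∃ v, α v ≠ 0 := by
      by_contra! hc
      exact h0 (LinearMap.ext hc)
    refine ⟨β v / α v, LinearMap.ext fun x => ?_⟩
    have hx : x - (α x / α v) • v ∈ LinearMap.ker α := by
      simp [hv]
    rw [h] at hx
    simp only [LinearMap.mem_ker, map_sub, map_smul, smul_eq_mul] at hx
    simp only [LinearMap.smul_apply, smul_eq_mul]
    linear_combination hx

theorem finite_faces (A : CentralArrangement V) : A.faces.Finite := by
  choose f hf using fun H : A.hyperplanes => exists_form (A.codim_one H H.2)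
  let s : V → A.hyperplanes → SignType := fun x H => SignType.sign (f H x)
  have key : ∀ x y, s x = s y → A.stratum x = A.stratum y := by
    intro x y hxy
    have : ∀ H ∈ A.hyperplanes, ∀ α : Module.Dual ℝ V, LinearMap.ker α = H →
        SignType.sign (α x) = SignType.sign (α y) := by
      intro H hH α hα
      obtain ⟨c, rfl⟩ := exists_eq_smul ((hf ⟨H, hH⟩).trans hα.symm)
      have := congrFun hxy ⟨H, hH⟩
      simp only [s] at this
      simp [sign_mul, this]
    ext z
    exact ⟨fun h H hH α hα => (h H hH α hα).trans (this H hH α hα),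
      fun h H hH α hα => (h H hH α hα).trans (this H hH α hα).symm⟩
  let g : (A.hyperplanes → SignType) → Set V := fun t => {z | ∃ x, s x = t ∧ z ∈ A.stratum x}
  refine (Set.finite_range g).subset ?_
  rintro _ ⟨x, rfl⟩
  refine ⟨s x, ?_⟩
  ext z
  constructor
  · rintro ⟨y, hy, hz⟩
    rwa [← key y x hy]
  · exact fun hz => ⟨x, rfl, hz⟩

instance fintypeFaces (A : CentralArrangement V) : Fintype A.faces :=
  A.finite_faces.fintype

end Linear

section Topological

variable {V : Type*} [NormedAddCommGroup V] [NormedSpace ℝ V]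

/-- The chambers: the connected components of the complement of the union of the hyperplanes. -/
def chambers (A : CentralArrangement V) : Set (Set V) :=
  connectedComponentIn A.complement '' A.complement

theorem nonempty_of_mem_chambers {A : CentralArrangement V} {C : Set V} (hC : C ∈ A.chambers) :
    C.Nonempty := by
  obtain ⟨x, hx, rfl⟩ := hC
  exact ⟨x, mem_connectedComponentIn hx⟩

theorem convex_stratum (A : CentralArrangement V) (x : V) : Convex ℝ (A.stratum x) := by
  intro y hy z hz a b ha hb hab H hH α hα
  have h1 := hy H hH α hα
  have h2 := hz H hH α hα
  simp only [map_add, map_smul, smul_eq_mul]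
  rcases lt_trichotomy (α x) 0 with h | h | h
  · rw [sign_neg h, sign_eq_neg_one_iff] at h1 h2
    rw [sign_neg h, sign_eq_neg_one_iff]
    rcases ha.eq_or_lt with rfl | ha
    · simp_all
    · nlinarith [mul_neg_of_pos_of_neg ha h1, mul_nonpos_of_nonneg_of_nonpos hb h2.le]
  · rw [h, sign_zero, sign_eq_zero_iff] at h1 h2
    simp [h, h1, h2]
  · rw [sign_pos h, sign_eq_one_iff] at h1 h2
    rw [sign_pos h, sign_eq_one_iff]
    rcases ha.eq_or_lt with rfl | ha
    · simp_all
    · nlinarith [mul_pos ha h1, mul_nonneg hb h2.le]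

theorem finite_chambers (A : CentralArrangement V) : A.chambers.Finite := by
  let g : Set V → Set V := fun F => {z | ∃ x ∈ F, z ∈ connectedComponentIn A.complement x}
  refine (A.finite_faces.image g).subset ?_
  rintro _ ⟨x, hx, rfl⟩
  refine ⟨A.stratum x, ⟨x, rfl⟩, ?_⟩
  have hxs : x ∈ A.stratum x := fun H hH α hα => rfl
  have hsub : A.stratum x ⊆ A.complement := by
    intro y hy H hH hyH
    obtain ⟨α, hα⟩ := exists_form (A.codim_one H hH)
    have h1 := hy H hH α hα
    rw [← hα, LinearMap.mem_ker] at hyH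
    rw [hyH, sign_zero] at h1
    refine hx H hH ?_
    rw [← hα, LinearMap.mem_ker]
    exact sign_eq_zero_iff.mp h1.symm
  have hcomp : A.stratum x ⊆ connectedComponentIn A.complement x :=
    (A.convex_stratum x).isPreconnected.subset_connectedComponentIn hxs hsub
  ext z
  constructor
  · rintro ⟨y, hy, hz⟩
    rwa [connectedComponentIn_eq (hcomp hy)]
  · exact fun hz => ⟨x, hxs, hz⟩

instance fintypeChambers (A : CentralArrangement V) : Fintype A.chambers :=
  A.finite_chambers.fintype

/-- The tope graph: its vertices are the chambers, and two chambers are adjacent if exactly one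
hyperplane of the arrangement separates them. -/
def topeGraph (A : CentralArrangement V) : SimpleGraph A.chambers where
  Adj C D := (A.separating C D).card = 1
  symm := ⟨fun C D h => by
    have : A.separating D C = A.separating C D := by
      ext H
      simp only [mem_separating]
      exact and_congr_right fun _ => ⟨Separates.symm, Separates.symm⟩
    rwa [this]⟩
  loopless := ⟨fun C h => by
    obtain ⟨H, hH⟩ := Finset.card_eq_one.mp h
    have hmem : H ∈ A.separating C C := by rw [hH]; exact Finset.mem_singleton_self H
    obtain ⟨α, -, h1, h2⟩ := (mem_separating.mp hmem).2
    obtain ⟨x, hx⟩ := nonempty_of_mem_chambers C.2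
    exact lt_asymm (h1 x hx) (h2 x hx)⟩

/-- The magnitude `Mag(A, q)` in `ℚ(q)`. -/
def mag (A : CentralArrangement V) : RatFunc ℚ :=
  A.topeGraph.magnitude

/-- The interior magnitude `Mag°(A, q) = (-1) ^ rank A * Mag(A, q⁻¹)`, where `q⁻¹` is substituted
for `q` in the rational function `Mag(A, q)`. -/
def interiorMag (A : CentralArrangement V) : RatFunc ℚ :=
  (-1) ^ A.rank * RatFunc.eval RatFunc.C (RatFunc.X : RatFunc ℚ)⁻¹ A.mag

end Topological

end CentralArrangement

end

/-! A weighting is a solution of `Z w = 1`; as `Z` is invertible, the entries of any weighting add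
up to the magnitude. Distance in the tope graph counts separating hyperplanes
(`topeGraph_reachable_and_dist`), so everything can be phrased in sign vectors.

Choose a weighting `w_F` of each localization `A_F`, and give a chamber `C` the weight `∑ (-1)^codim
F q^#A_F w_F(C_F)`, over the faces `F` of `C`, where `C_F` is the chamber of `A_F` containing `C`.
The chambers having `F` as a face correspond to all chambers of `A_F`, so the total weight is the
second sum of the theorem. It remains to see that this is a weighting (`isWeighting_facewise`). For
a chamber `B` and a face `F` of `C`, `d(B, C)` is the number of hyperplanes off `F` separating `B`
from `F`, plus the distance of `B_F` and `C_F`. The property of `w_F` therefore collapses row `B` of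
`Z w` to `∑_F (-1)^codim F q^d(B, F)`, where `d(B, F)` counts the hyperplanes at which the signs
differ. This is 1 (`sum_covectors_pow`): expanding the powers of `q` reduces it to the Euler
relation for open cones (`sum_covectors_cone`), proved by adding hyperplanes one at a time.

The antipodal map gives `d(C, -D) = #A - d(C, D)`, hence `Mag(q⁻¹) = q^#A Mag(q)`
(`interiorMag_eq`). With `codim F = rank A_F` (`codim_stratum`), the two sums agree term by term. -/

open Filter Topology in
theorem eventually_sign_add_mul (a b : ℝ) : ∀ᶠ ε in 𝓝[>] (0 : ℝ),
    SignType.sign (a + ε * b) = if a = 0 then SignType.sign b else SignType.sign a := by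
  by_cases ha : a = 0
  · filter_upwards [self_mem_nhdsWithin] with ε hε
    simp [ha, sign_mul, sign_pos (show (0 : ℝ) < ε from hε)]
  · simp only [ha, if_false]
    have hc : Tendsto (fun ε : ℝ => a + ε * b) (𝓝[>] 0) (𝓝 a) := by
      have : Continuous fun ε : ℝ => a + ε * b := by fun_prop
      have h := this.tendsto 0
      simp only [zero_mul, add_zero] at h
      exact h.mono_left nhdsWithin_le_nhds
    rcases lt_or_gt_of_ne ha with h | h
    · filter_upwards [hc.eventually (eventually_lt_nhds h)] with ε hε
      rw [sign_neg h, sign_neg hε]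
    · filter_upwards [hc.eventually (eventually_gt_nhds h)] with ε hε
      rw [sign_pos h, sign_pos hε]

/-! ### Covectors of linear forms and the Euler relation -/

namespace LinearForms

open scoped Classical

noncomputable section Covectors

variable {V : Type*} [AddCommGroup V] [Module ℝ V] {ι : Type*}

/-- The sign vector of a point with respect to the forms indexed by `s`, extended by zero. -/
def sgn (α : ι → Module.Dual ℝ V) (s : Finset ι) (x : V) : ι → SignType :=
  fun i => if i ∈ s then SignType.sign (α i x) else 0

/-- The zero set in `s` of a sign vector. -/
def zeros (s : Finset ι) (X : ι → SignType) : Finset ι :=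
  s.filter fun i => X i = 0

/-- The restriction of a sign vector to `s`, extended by zero. -/
def restrict (s : Finset ι) (X : ι → SignType) : ι → SignType :=
  fun i => if i ∈ s then X i else 0

/-- The number of indices in `s` at which two sign vectors differ. -/
def signDist (s : Finset ι) (X Y : ι → SignType) : ℕ :=
  (s.filter fun i => X i ≠ Y i).card

theorem finite_range_sgn (α : ι → Module.Dual ℝ V) (s : Finset ι) :
    (Set.range (sgn α s)).Finite := by
  refine Set.Finite.of_finite_image (f := fun X (i : s) => X i) (Set.toFinite _) ?_
  rintro _ ⟨x, rfl⟩ _ ⟨y, rfl⟩ h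
  funext i
  by_cases hi : i ∈ s
  · exact congrFun h ⟨i, hi⟩
  · simp [sgn, hi]

/-- The covectors of the forms indexed by `s`. -/
def covectors (α : ι → Module.Dual ℝ V) (s : Finset ι) : Finset (ι → SignType) :=
  (finite_range_sgn α s).toFinset

/-- The covectors without zeros in `s`. -/
def topes (α : ι → Module.Dual ℝ V) (s : Finset ι) : Finset (ι → SignType) :=
  (covectors α s).filter fun X => ∀ i ∈ s, X i ≠ 0

/-- The codimension of the common kernel of the forms indexed by `s`. -/
def codimKer (α : ι → Module.Dual ℝ V) (s : Finset ι) : ℕ :=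
  Module.finrank ℝ (V ⧸ (⨅ i ∈ s, LinearMap.ker (α i)))

variable {α : ι → Module.Dual ℝ V} {s : Finset ι}

theorem mem_covectors {X : ι → SignType} : X ∈ covectors α s ↔ ∃ x, sgn α s x = X := by
  simp [covectors]

theorem mem_topes {X : ι → SignType} :
    X ∈ topes α s ↔ (∃ x, sgn α s x = X) ∧ ∀ i ∈ s, X i ≠ 0 := by
  simp [topes, mem_covectors]

theorem sgn_of_mem {i : ι} (hi : i ∈ s) (x : V) : sgn α s x i = SignType.sign (α i x) := by
  simp [sgn, hi]

theorem sgn_eq_iff {x y : V} :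
    sgn α s x = sgn α s y ↔ ∀ i ∈ s, SignType.sign (α i x) = SignType.sign (α i y) := by
  refine ⟨fun h i hi => ?_, fun h => funext fun i => ?_⟩
  · simpa [sgn, hi] using congrFun h i
  · by_cases hi : i ∈ s
    · simp [sgn, hi, h i hi]
    · simp [sgn, hi]

theorem restrict_sgn {t : Finset ι} (h : t ⊆ s) (x : V) :
    restrict t (sgn α s x) = sgn α t x := by
  funext i
  by_cases hi : i ∈ t
  · simp [restrict, sgn, hi, h hi]
  · simp [restrict, sgn, hi]

theorem mem_zeros {X : ι → SignType} {i : ι} : i ∈ zeros s X ↔ i ∈ s ∧ X i = 0 := by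
  simp [zeros]

theorem mem_zeros_sgn {x : V} {i : ι} : i ∈ zeros s (sgn α s x) ↔ i ∈ s ∧ α i x = 0 := by
  rw [mem_zeros]
  exact and_congr_right fun hi => by rw [sgn_of_mem hi, sign_eq_zero_iff]

/-- Moving a little from `x` in the direction `v` composes the sign vectors. -/
theorem exists_sgn_compose (α : ι → Module.Dual ℝ V) (s : Finset ι) (x v : V) :
    ∃ y, ∀ i ∈ s, SignType.sign (α i y) =
      if α i x = 0 then SignType.sign (α i v) else SignType.sign (α i x) := by
  have h : ∀ᶠ ε in nhdsWithin (0 : ℝ) (Set.Ioi 0), ∀ i ∈ s, SignType.sign (α i x + ε * α i v) =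
      if α i x = 0 then SignType.sign (α i v) else SignType.sign (α i x) :=
    (Filter.eventually_all_finset s).2 fun i _ => eventually_sign_add_mul _ _
  obtain ⟨ε, hε⟩ := h.exists
  exact ⟨x + ε • v, fun i hi => by simpa using hε i hi⟩

theorem codimKer_insert_of_le {i : ι}
    (h : (⨅ j ∈ s, LinearMap.ker (α j)) ≤ LinearMap.ker (α i)) :
    codimKer α (insert i s) = codimKer α s := by
  rw [codimKer, codimKer, Finset.iInf_insert, inf_eq_right.2 h]

theorem codimKer_insert_of_not_le [FiniteDimensional ℝ V] {i : ι}
    (h : ¬ (⨅ j ∈ s, LinearMap.ker (α j)) ≤ LinearMap.ker (α i)) :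
    codimKer α (insert i s) = codimKer α s + 1 := by
  rw [codimKer, codimKer, Finset.iInf_insert]
  set W := ⨅ j ∈ s, LinearMap.ker (α j)
  have h1 := Submodule.finrank_quotient_add_finrank W
  have h2 := Submodule.finrank_quotient_add_finrank (LinearMap.ker (α i) ⊓ W)
  have h0 : (α i).domRestrict W ≠ 0 := by
    intro h0
    refine h fun v hv => ?_
    exact LinearMap.congr_fun h0 ⟨v, hv⟩
  have h3 := Module.Dual.finrank_ker_add_one_of_ne_zero h0
  have h4 : Module.finrank ℝ (LinearMap.ker ((α i).domRestrict W)) =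
      Module.finrank ℝ (LinearMap.ker (α i) ⊓ W : Submodule ℝ V) := by
    rw [← LinearMap.finrank_range_of_inj (f := W.subtype ∘ₗ
      (LinearMap.ker ((α i).domRestrict W)).subtype)
      (by exact Subtype.val_injective.comp Subtype.val_injective), LinearMap.range_comp,
      Submodule.range_subtype]
    have hmap : (LinearMap.ker ((α i).domRestrict W)).map W.subtype = LinearMap.ker (α i) ⊓ W := by
      ext v
      simp [and_comm]
    rw [hmap]
  omega

theorem mem_iInf_ker {t : Finset ι} {v : V} :
    v ∈ (⨅ j ∈ t, LinearMap.ker (α j)) ↔ ∀ j ∈ t, α j v = 0 := by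
  simp [Submodule.mem_iInf]

/-- A new hyperplane either misses the open cell of `σ`, contains it, or cuts it into two pieces of
the same codimension `k` and a wall of codimension `k + 1`; in the last case `2 (-1)^k + (-1)^(k+1)
= (-1)^k`. -/
theorem covector_step [FiniteDimensional ℝ V] {i : ι} (hi : i ∉ s) {σ : ι → SignType}
    (hσ : σ ∈ covectors α s) :
    ∑ X ∈ covectors α (insert i s) with restrict s X = σ,
      (-1 : ℤ) ^ codimKer α (zeros (insert i s) X) = (-1) ^ codimKer α (zeros s σ) := by
  obtain ⟨x, rfl⟩ := mem_covectors.1 hσ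
  set σ := sgn α s x with hσ_def
  have hσi : σ i = 0 := by simp [hσ_def, sgn, hi]
  let f : SignType → ι → SignType := fun t => Function.update σ i t
  have hf : Function.Injective f := Function.update_injective σ i
  have hres : ∀ t, restrict s (f t) = σ := by
    intro t
    funext j
    by_cases hj : j ∈ s
    · have : j ≠ i := fun h => hi (h ▸ hj)
      simp [restrict, f, hj, this]
    · simp [restrict, hj, hσ_def, sgn]
  have hsgn : ∀ y, sgn α s y = σ → sgn α (insert i s) y = f (SignType.sign (α i y)) := by
    intro y hy
    funext j
    by_cases hj : j = i
    · subst hj; simp [sgn, f]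
    · have := congrFun hy j
      simpa [sgn, f, hj] using this
  -- The covectors over `σ` correspond to the signs that `α i` takes on the cell of `σ`.
  have hset : ((covectors α (insert i s)).filter fun X => restrict s X = σ) =
      (Finset.univ.filter fun t => ∃ y, sgn α s y = σ ∧ SignType.sign (α i y) = t).image f := by
    ext X
    simp only [Finset.mem_filter, mem_covectors, Finset.mem_image, Finset.mem_univ, true_and]
    constructor
    · rintro ⟨⟨y, rfl⟩, h⟩
      rw [restrict_sgn (Finset.subset_insert i s)] at h
      exact ⟨_, ⟨y, h, rfl⟩, (hsgn y h).symm⟩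
    · rintro ⟨_, ⟨y, h, rfl⟩, rfl⟩
      exact ⟨⟨y, hsgn y h⟩, hres _⟩
  have hz0 : zeros (insert i s) (f 0) = insert i (zeros s σ) := by
    have : f 0 = σ := by simp [f, ← hσi]
    rw [this, zeros, Finset.filter_insert, if_pos hσi, zeros]
  have hz1 : ∀ t, t ≠ 0 → zeros (insert i s) (f t) = zeros s σ := by
    intro t ht
    rw [zeros, Finset.filter_insert, if_neg (by simpa [f] using ht), zeros]
    refine Finset.filter_congr fun j hj => ?_
    have : j ≠ i := fun h => hi (h ▸ hj)
    simp [f, this]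
  rw [hset, Finset.sum_image hf.injOn]
  by_cases hle : (⨅ j ∈ zeros s σ, LinearMap.ker (α j)) ≤ LinearMap.ker (α i)
  · have : (Finset.univ.filter fun t => ∃ y, sgn α s y = σ ∧ SignType.sign (α i y) = t) = {0} := by
      have hy0 : ∀ y, sgn α s y = σ → α i y = 0 := fun y hy =>
        hle (mem_iInf_ker.2 fun j hj => (mem_zeros_sgn.1 (hy ▸ hj)).2)
      ext t
      simp only [Finset.mem_filter, Finset.mem_univ, true_and, Finset.mem_singleton]
      constructor
      · rintro ⟨y, hy, rfl⟩
        simp [hy0 y hy]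
      · rintro rfl
        exact ⟨x, rfl, by simp [hy0 x rfl]⟩
    rw [this, Finset.sum_singleton, hz0, codimKer_insert_of_le hle]
  · have hc := codimKer_insert_of_not_le hle
    obtain ⟨v, hv, hvi⟩ := SetLike.not_le_iff_exists.1 hle
    rw [mem_iInf_ker] at hv
    have hvi : α i v ≠ 0 := hvi
    by_cases hex : ∃ y, sgn α s y = σ ∧ α i y = 0
    · obtain ⟨y, hy, hyi⟩ := hex
      have hall : (Finset.univ.filter fun t => ∃ y, sgn α s y = σ ∧ SignType.sign (α i y) = t) =
          Finset.univ := by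
        -- All forms vanishing on the cell vanish at `v`, so a small move along `v` stays in the
        -- cell while `α i` changes freely.
        have hmove : ∀ c : ℝ, ∃ z, sgn α s z = σ ∧
            SignType.sign (α i z) = SignType.sign (c * α i v) := by
          intro c
          obtain ⟨z, hz⟩ := exists_sgn_compose α (insert i s) y (c • v)
          refine ⟨z, ?_, by simpa [hyi] using hz i (Finset.mem_insert_self i s)⟩
          rw [← hy, sgn_eq_iff]
          intro j hj
          rw [hz j (Finset.mem_insert_of_mem hj)]
          split_ifs with h0
          · have := hv j (by rw [← hy]; exact mem_zeros_sgn.2 ⟨hj, h0⟩)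
            simp [this, h0]
          · rfl
        refine Finset.filter_true_of_mem fun t _ => ?_
        obtain ⟨c, hc⟩ : ∃ c : ℝ, SignType.sign c = t := by
          cases t
          exacts [⟨0, sign_zero⟩, ⟨-1, sign_neg (by norm_num)⟩, ⟨1, sign_one⟩]
        obtain ⟨z, hz, hzi⟩ := hmove (c / α i v)
        refine ⟨z, hz, ?_⟩
        rw [hzi, div_mul_cancel₀ _ hvi, hc]
      have huniv : (Finset.univ : Finset SignType) = {0, -1, 1} := by decide
      rw [hall, huniv, Finset.sum_insert (by decide), Finset.sum_insert (by decide),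
        Finset.sum_singleton, hz0, hz1 _ (by decide), hz1 _ (by decide), hc, pow_succ]
      ring
    · have hx0 : α i x ≠ 0 := fun h => hex ⟨x, rfl, h⟩
      have : (Finset.univ.filter fun t => ∃ y, sgn α s y = σ ∧ SignType.sign (α i y) = t) =
          {SignType.sign (α i x)} := by
        ext t
        simp only [Finset.mem_filter, Finset.mem_univ, true_and, Finset.mem_singleton]
        refine ⟨?_, fun h => ⟨x, rfl, h.symm⟩⟩
        rintro ⟨y, hy, rfl⟩
        by_contra hne
        have hy0 : α i y ≠ 0 := fun h => hex ⟨y, hy, h⟩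
        have hpos : 0 < |α i x| := abs_pos.2 hx0
        have hpos' : 0 < |α i y| := abs_pos.2 hy0
        -- With opposite signs at `x` and `y`, this positive combination would lie in the cell and
        -- in the kernel of `α i`.
        refine hex ⟨|α i y| • x + |α i x| • y, ?_, ?_⟩
        · rw [hσ_def, sgn_eq_iff]
          intro j hj
          have hj' := (sgn_eq_iff.1 (hy.trans hσ_def)) j hj
          rcases lt_trichotomy (α j x) 0 with h | h | h
          · rw [sign_neg h, sign_eq_neg_one_iff] at hj'
            rw [sign_neg h, sign_eq_neg_one_iff]
            simp only [map_add, map_smul, smul_eq_mul]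
            nlinarith [mul_neg_of_pos_of_neg hpos' h, mul_neg_of_pos_of_neg hpos hj']
          · rw [h, sign_zero, sign_eq_zero_iff] at hj'
            simp [h, hj']
          · rw [sign_pos h, sign_eq_one_iff] at hj'
            rw [sign_pos h, sign_eq_one_iff]
            simp only [map_add, map_smul, smul_eq_mul]
            nlinarith [mul_pos hpos' h, mul_pos hpos hj']
        · simp only [map_add, map_smul, smul_eq_mul]
          rcases lt_or_gt_of_ne hx0 with h | h <;> rcases lt_or_gt_of_ne hy0 with h' | h'
          · simp [sign_neg h, sign_neg h'] at hne
          · rw [abs_of_neg h, abs_of_pos h']; ring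
          · rw [abs_of_pos h, abs_of_neg h']; ring
          · simp [sign_pos h, sign_pos h'] at hne
      rw [this, Finset.sum_singleton, hz1 _ (by simpa [sign_eq_zero_iff] using hx0)]

/-- The Euler relation: the covectors in the open cone around `b` cut out by the forms of `S` have
alternating sum one. -/
theorem sum_covectors_cone [FiniteDimensional ℝ V] {S : Finset ι} {b : V}
    (hb : ∀ i ∈ S, α i b ≠ 0) (t : Finset ι) (ht : Disjoint t S) :
    ∑ X ∈ covectors α (S ∪ t) with (∀ i ∈ S, X i = SignType.sign (α i b)),
      (-1 : ℤ) ^ codimKer α (zeros (S ∪ t) X) = 1 := by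
  induction t using Finset.induction_on with
  | empty =>
    have : ((covectors α (S ∪ ∅)).filter fun X => ∀ i ∈ S, X i = SignType.sign (α i b)) =
        {sgn α S b} := by
      ext X
      simp only [Finset.union_empty, Finset.mem_filter, mem_covectors, Finset.mem_singleton]
      constructor
      · rintro ⟨⟨y, rfl⟩, h⟩
        exact sgn_eq_iff.2 fun i hi => by rw [← h i hi, sgn_of_mem hi]
      · rintro rfl
        exact ⟨⟨b, rfl⟩, fun i hi => sgn_of_mem hi b⟩
    rw [this, Finset.sum_singleton]
    have hz : zeros (S ∪ ∅) (sgn α S b) = ∅ := by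
      ext i
      rw [Finset.union_empty, mem_zeros_sgn]
      simpa using hb i
    have h0 : codimKer α (∅ : Finset ι) = 0 := by
      rw [codimKer]
      have := Submodule.finrank_quotient_add_finrank (⊤ : Submodule ℝ V)
      have htop : (⨅ i ∈ (∅ : Finset ι), LinearMap.ker (α i)) = ⊤ := by simp
      rw [finrank_top] at this
      rw [htop]
      omega
    rw [hz, h0, pow_zero]
  | insert i t hit ih =>
    rw [Finset.disjoint_insert_left] at ht
    refine Eq.trans ?_ (ih ht.2)
    rw [Finset.union_insert]
    have hi : i ∉ S ∪ t := by simp [ht.1, hit]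
    have hmap : ∀ X ∈ (covectors α (insert i (S ∪ t))).filter
        (fun X => ∀ i ∈ S, X i = SignType.sign (α i b)), restrict (S ∪ t) X ∈
        (covectors α (S ∪ t)).filter fun X => ∀ i ∈ S, X i = SignType.sign (α i b) := by
      intro X hX
      rw [Finset.mem_filter, mem_covectors] at hX ⊢
      obtain ⟨⟨y, rfl⟩, h⟩ := hX
      refine ⟨⟨y, (restrict_sgn (Finset.subset_insert _ _) y).symm⟩, fun j hj => ?_⟩
      rw [← h j hj]
      simp [restrict, hj]
    -- The cone condition involves only `S`, so it depends only on the restriction and every fibre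
    -- is a full fibre of `covector_step`.
    rw [← Finset.sum_fiberwise_of_maps_to hmap]
    refine Finset.sum_congr rfl fun σ hσ => ?_
    rw [Finset.mem_filter] at hσ
    rw [← covector_step hi hσ.1, Finset.filter_filter]
    refine Finset.sum_congr (Finset.filter_congr fun X _ => ?_) fun _ _ => rfl
    refine ⟨fun h => h.2, fun h => ⟨fun j hj => ?_, h⟩⟩
    rw [← hσ.2 j hj, ← h]
    simp [restrict, hj]

/-- Write each factor of `q ^ signDist` as `(1 - q) [X i = B i] + q` and expand over subsets `S`. By
the Euler relation the covectors agreeing with `B` on `S` contribute 1, which leaves the binomial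
expansion of `((1 - q) + q)^#s`. -/
theorem sum_covectors_pow [FiniteDimensional ℝ V] {K : Type*} [CommRing K] (q : K)
    {B : ι → SignType} (hB : B ∈ topes α s) :
    ∑ X ∈ covectors α s, (-1) ^ codimKer α (zeros s X) * q ^ signDist s B X = 1 := by
  obtain ⟨⟨b, rfl⟩, hb⟩ := mem_topes.1 hB
  have hpow : ∀ X : ι → SignType, q ^ signDist s (sgn α s b) X =
      ∑ S ∈ s.powerset, if ∀ i ∈ S, X i = SignType.sign (α i b) then
        (1 - q) ^ S.card * q ^ (s \ S).card else 0 := by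
    intro X
    have h1 : q ^ signDist s (sgn α s b) X =
        ∏ i ∈ s, ((if X i = SignType.sign (α i b) then 1 - q else 0) + q) := by
      rw [signDist, Finset.card_filter, ← Finset.prod_pow_eq_pow_sum]
      refine Finset.prod_congr rfl fun i hi => ?_
      rw [sgn_of_mem hi]
      by_cases h : X i = SignType.sign (α i b)
      · simp [h]
      · simp [h, Ne.symm h]
    rw [h1, Finset.prod_add]
    refine Finset.sum_congr rfl fun S _ => ?_
    rw [Finset.prod_const]
    split_ifs with h
    · rw [Finset.prod_congr rfl fun i hi => if_pos (h i hi), Finset.prod_const]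
    · push Not at h
      obtain ⟨i, hi, hne⟩ := h
      rw [Finset.prod_eq_zero hi (if_neg hne), zero_mul]
  simp only [hpow, Finset.mul_sum]
  rw [Finset.sum_comm]
  have hsum : ∀ S ∈ s.powerset, ∑ X ∈ covectors α s, (-1) ^ codimKer α (zeros s X) *
      (if ∀ i ∈ S, X i = SignType.sign (α i b) then (1 - q) ^ S.card * q ^ (s \ S).card else 0) =
      (1 - q) ^ S.card * q ^ (s \ S).card := by
    intro S hS
    rw [Finset.mem_powerset] at hS
    have h := sum_covectors_cone (α := α) (S := S) (b := b)
      (fun i hi => by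
        have := hb i (hS hi)
        rwa [sgn_of_mem (hS hi), Ne, sign_eq_zero_iff] at this) (s \ S) Finset.sdiff_disjoint
    rw [Finset.union_sdiff_of_subset hS] at h
    have h' := congrArg (Int.cast : ℤ → K) h
    push_cast at h'
    simp only [mul_ite, mul_zero]
    rw [← Finset.sum_filter, ← Finset.sum_mul, h', one_mul]
  rw [Finset.sum_congr rfl hsum]
  have h : ∀ S ∈ s.powerset, (1 - q) ^ S.card * q ^ (s \ S).card =
      (1 - q) ^ S.card * q ^ (s.card - S.card) := fun S hS => by
    rw [Finset.card_sdiff_of_subset (Finset.mem_powerset.1 hS)]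
  rw [Finset.sum_congr rfl h, Finset.sum_pow_mul_eq_add_pow, sub_add_cancel, one_pow]

end Covectors
end LinearForms

/-! ### Weightings, their localization and their behaviour under `q ↦ q⁻¹` -/

namespace LinearForms

open scoped Classical

noncomputable section Weighting

variable {V : Type*} [AddCommGroup V] [Module ℝ V] {ι : Type*} {α : ι → Module.Dual ℝ V}
  {s : Finset ι}

/-- `C` agrees with `X` at every index in `s` at which `X` does not vanish. -/
def Conforms (s : Finset ι) (X C : ι → SignType) : Prop :=
  ∀ i ∈ s, X i ≠ 0 → C i = X i

theorem zeros_subset (X : ι → SignType) : zeros s X ⊆ s :=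
  Finset.filter_subset _ _

theorem restrict_mem_topes {t : Finset ι} (h : t ⊆ s) {C : ι → SignType} (hC : C ∈ topes α s) :
    restrict t C ∈ topes α t := by
  obtain ⟨⟨x, rfl⟩, hx⟩ := mem_topes.1 hC
  refine mem_topes.2 ⟨⟨x, (restrict_sgn h x).symm⟩, fun i hi => ?_⟩
  simpa [restrict, hi] using hx i (h hi)

theorem apply_eq_zero_of_mem_covectors {X : ι → SignType} (hX : X ∈ covectors α s) {i : ι}
    (hi : i ∉ s) : X i = 0 := by
  obtain ⟨x, rfl⟩ := mem_covectors.1 hX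
  simp [sgn, hi]

/-- The topes conforming to a covector `X` are the topes of the localization at `X`. -/
theorem sum_conforming {K : Type*} [AddCommMonoid K] {X : ι → SignType} (hX : X ∈ covectors α s)
    (f : (ι → SignType) → K) :
    ∑ C ∈ topes α s with Conforms s X C, f (restrict (zeros s X) C) =
      ∑ C ∈ topes α (zeros s X), f C := by
  refine Finset.sum_nbij (restrict (zeros s X)) ?_ ?_ ?_ fun _ _ => rfl
  · intro C hC
    exact restrict_mem_topes (zeros_subset X) (Finset.mem_filter.1 hC).1
  · intro C hC D hD h
    simp only [Finset.coe_filter, Set.mem_ofPred_eq] at hC hD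
    funext i
    by_cases hi : i ∈ s
    · by_cases hXi : X i = 0
      · simpa [restrict, mem_zeros, hi, hXi] using congrFun h i
      · rw [hC.2 i hi hXi, hD.2 i hi hXi]
    · rw [apply_eq_zero_of_mem_covectors (Finset.mem_filter.1 hC.1).1 hi,
        apply_eq_zero_of_mem_covectors (Finset.mem_filter.1 hD.1).1 hi]
  · intro D hD
    obtain ⟨⟨y, rfl⟩, hy⟩ := mem_topes.1 hD
    obtain ⟨x, rfl⟩ := mem_covectors.1 hX
    -- The composition of `X` with a tope of the localization is the tope of `s` lifting it.
    obtain ⟨z, hz⟩ := exists_sgn_compose α s x y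
    refine ⟨sgn α s z, ?_, ?_⟩
    · simp only [Finset.coe_filter, Set.mem_ofPred_eq, mem_topes]
      refine ⟨⟨⟨z, rfl⟩, fun i hi => ?_⟩, fun i hi h => ?_⟩
      · rw [sgn_of_mem hi, hz i hi]
        split_ifs with h0
        · have hmem := mem_zeros_sgn.2 ⟨hi, h0⟩
          simpa [sgn_of_mem hmem] using hy i hmem
        · simpa [sign_eq_zero_iff] using h0
      · rw [sgn_of_mem hi] at h ⊢
        rw [hz i hi, if_neg (by simpa [sign_eq_zero_iff] using h), sgn_of_mem hi]
    · rw [restrict_sgn (zeros_subset _), sgn_eq_iff]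
      intro i hi
      have := mem_zeros_sgn.1 hi
      rw [hz i this.1, if_pos this.2]

/-- A weighting of the tope graph: a solution of `Z w = 1`. -/
def IsWeighting {K : Type*} [CommRing K] (q : K) (α : ι → Module.Dual ℝ V) (s : Finset ι)
    (w : (ι → SignType) → K) : Prop :=
  ∀ C ∈ topes α s, ∑ D ∈ topes α s, q ^ signDist s C D * w D = 1

/-- The combination of weightings of the localizations that is a weighting of the whole. -/
def facewise {K : Type*} [CommRing K] (q : K) (α : ι → Module.Dual ℝ V) (s : Finset ι)
    (w : Finset ι → (ι → SignType) → K) (C : ι → SignType) : K :=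
  ∑ X ∈ covectors α s with Conforms s X C, (-1) ^ codimKer α (zeros s X) *
    q ^ (zeros s X).card * w (zeros s X) (restrict (zeros s X) C)

/-- Exchanges chambers and faces. The test function `g` is 1 for the total weight and `q ^ signDist
s B` for the row of `B`. -/
theorem sum_mul_facewise {K : Type*} [CommRing K] (q : K) (w : Finset ι → (ι → SignType) → K)
    (g : (ι → SignType) → K) :
    ∑ C ∈ topes α s, g C * facewise q α s w C =
      ∑ X ∈ covectors α s, (-1) ^ codimKer α (zeros s X) * q ^ (zeros s X).card *
        ∑ C ∈ topes α s with Conforms s X C, g C * w (zeros s X) (restrict (zeros s X) C) := by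
  simp only [facewise, Finset.mul_sum, Finset.sum_filter]
  rw [Finset.sum_comm]
  refine Finset.sum_congr rfl fun X _ => Finset.sum_congr rfl fun C _ => ?_
  split_ifs
  · ring
  · simp

theorem sum_facewise {K : Type*} [CommRing K] (q : K) (w : Finset ι → (ι → SignType) → K) :
    ∑ C ∈ topes α s, facewise q α s w C =
      ∑ X ∈ covectors α s, (-1) ^ codimKer α (zeros s X) * q ^ (zeros s X).card *
        ∑ C ∈ topes α (zeros s X), w (zeros s X) C := by
  have h := sum_mul_facewise (α := α) (s := s) q w fun _ => 1
  simp only [one_mul] at h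
  rw [h]
  refine Finset.sum_congr rfl fun X hX => ?_
  rw [sum_conforming hX]

theorem card_filter_zeros_add (X : ι → SignType) (p : ι → Prop) [DecidablePred p] :
    (s.filter p).card = ((zeros s X).filter p).card + (s.filter fun i => X i ≠ 0 ∧ p i).card := by
  rw [zeros, ← Finset.card_filter_add_card_filter_not (s := s.filter p) (fun i => X i = 0),
    Finset.filter_filter, Finset.filter_filter, Finset.filter_filter]
  simp only [and_comm]

/-- For `C` conforming to `X`, the distance from `B` splits into a part `e` off the zeros of `X`,
independent of `C`, and the distance in the localization. The weighting there sums to 1, leaving `q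
^ e`. -/
theorem isWeighting_facewise [FiniteDimensional ℝ V] {K : Type*} [CommRing K] (q : K)
    (w : Finset ι → (ι → SignType) → K)
    (hw : ∀ X ∈ covectors α s, IsWeighting q α (zeros s X) (w (zeros s X))) :
    IsWeighting q α s (facewise q α s w) := by
  intro B hB
  rw [sum_mul_facewise]
  refine Eq.trans ?_ (sum_covectors_pow (α := α) q hB)
  refine Finset.sum_congr rfl fun X hX => ?_
  set e := (s.filter fun i => X i ≠ 0 ∧ B i ≠ X i).card
  -- A tope has no zeros, so it differs from `X` at every zero of `X`; this accounts for the factor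
  -- `q ^ (zeros s X).card`.
  have hd : signDist s B X = (zeros s X).card + e := by
    rw [signDist, card_filter_zeros_add X]
    congr 2
    refine Finset.filter_true_of_mem fun i hi => ?_
    rw [mem_zeros] at hi
    rw [hi.2]
    exact (mem_topes.1 hB).2 i hi.1
  have hsplit : ∀ C, Conforms s X C → signDist s B C =
      e + signDist (zeros s X) (restrict (zeros s X) B) (restrict (zeros s X) C) := by
    intro C hC
    rw [signDist, card_filter_zeros_add X, add_comm]
    congr 1
    · refine congrArg _ (Finset.filter_congr fun i hi => ?_)
      exact and_congr_right fun h => by rw [hC i hi h]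
    · refine congrArg _ (Finset.filter_congr fun i hi => ?_)
      simp [restrict, hi]
  have hsum : ∑ C ∈ topes α s with Conforms s X C,
      q ^ signDist s B C * w (zeros s X) (restrict (zeros s X) C) = q ^ e := by
    have := hw X hX _ (restrict_mem_topes (zeros_subset X) hB)
    rw [← sum_conforming hX fun D => q ^ signDist (zeros s X) (restrict (zeros s X) B) D *
      w (zeros s X) D] at this
    rw [← mul_one (q ^ e), ← this, Finset.mul_sum]
    refine Finset.sum_congr rfl fun C hC => ?_
    rw [hsplit C (Finset.mem_filter.1 hC).2, pow_add, mul_assoc]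
  rw [hsum, hd, pow_add, mul_assoc]

theorem neg_mem_topes {C : ι → SignType} (hC : C ∈ topes α s) : -C ∈ topes α s := by
  obtain ⟨⟨x, rfl⟩, hx⟩ := mem_topes.1 hC
  refine mem_topes.2 ⟨⟨-x, ?_⟩, fun i hi => by simpa using hx i hi⟩
  funext i
  by_cases hi : i ∈ s
  · simp [sgn, hi, Left.sign_neg]
  · simp [sgn, hi]

theorem sum_neg_topes {K : Type*} [AddCommMonoid K] (f : (ι → SignType) → K) :
    ∑ C ∈ topes α s, f (-C) = ∑ C ∈ topes α s, f C :=
  Finset.sum_nbij' (fun C => -C) (fun C => -C) (fun _ h => neg_mem_topes h)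
    (fun _ h => neg_mem_topes h) (fun _ _ => neg_neg _) (fun _ _ => neg_neg _) fun _ _ => rfl

theorem signDist_neg_add {C D : ι → SignType} (hC : C ∈ topes α s) (hD : D ∈ topes α s) :
    signDist s C (-D) + signDist s C D = s.card := by
  rw [signDist, signDist, ← Finset.card_filter_add_card_filter_not (s := s) (fun i => C i ≠ D i),
    add_comm]
  congr 2
  refine Finset.filter_congr fun i hi => ?_
  have h1 := (mem_topes.1 hC).2 i hi
  have h2 := (mem_topes.1 hD).2 i hi
  rw [Pi.neg_apply]
  revert h1 h2
  generalize C i = a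
  generalize D i = b
  revert a b
  decide

/-- Since `d(C, -D) = #s - d(C, D)`, reversing the topes turns powers of `q⁻¹` into powers of `q`,
up to the factor `q ^ s.card`. -/
theorem IsWeighting.inv {K : Type*} [Field K] {q : K} (hq : q ≠ 0) {w : (ι → SignType) → K}
    (hw : IsWeighting q α s w) : IsWeighting q⁻¹ α s fun C => q ^ s.card * w (-C) := by
  intro C hC
  rw [← hw C hC, ← sum_neg_topes]
  refine Finset.sum_congr rfl fun D hD => ?_
  simp only [neg_neg]
  rw [← signDist_neg_add hC (neg_mem_topes hD), neg_neg, pow_add, inv_pow, ← mul_assoc,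
    mul_comm (q ^ _) (q ^ _), inv_mul_cancel_left₀ (pow_ne_zero _ hq)]

theorem IsWeighting.map {K L : Type*} [CommRing K] [CommRing L] {q : K} {w : (ι → SignType) → K}
    (hw : IsWeighting q α s w) (φ : K →+* L) : IsWeighting (φ q) α s fun C => φ (w C) := by
  intro C hC
  have := congrArg φ (hw C hC)
  simpa using this

end Weighting

/-! ### Neighbouring chambers along a generic segment -/

section Segment

variable {V : Type*} [AddCommGroup V] [Module ℝ V] {ι : Type*} {α : ι → Module.Dual ℝ V}
  {s : Finset ι}

theorem exists_forall_apply_ne_zero (B : Finset (Module.Dual ℝ V)) (hB : ∀ β ∈ B, β ≠ 0) :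
    ∃ v, ∀ β ∈ B, β v ≠ 0 := by
  induction B using Finset.induction_on with
  | empty => exact ⟨0, by simp⟩
  | insert β B _ ih =>
    obtain ⟨v, hv⟩ := ih fun γ hγ => hB γ (Finset.mem_insert_of_mem hγ)
    obtain ⟨u, hu⟩ : ∃ u, β u ≠ 0 := by
      by_contra! h
      exact hB β (Finset.mem_insert_self _ _) (LinearMap.ext h)
    obtain ⟨y, hy⟩ := exists_sgn_compose (id : Module.Dual ℝ V → _) (insert β B) v u
    refine ⟨y, fun γ hγ => ?_⟩
    have := hy γ hγ
    simp only [id_eq] at this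
    rw [← sign_ne_zero, this]
    split_ifs with h0
    · rcases Finset.mem_insert.1 hγ with rfl | hγ'
      · exact sign_ne_zero.2 hu
      · exact absurd h0 (hv γ hγ')
    · exact sign_ne_zero.2 h0

/-- Between two different chambers there is a neighbour of the first one in the direction of the
second one. -/
theorem exists_neighbour (hα : ∀ i ∈ s, ∀ j ∈ s, LinearMap.ker (α i) = LinearMap.ker (α j) → i = j)
    {x y : V} (hx : ∀ i ∈ s, α i x ≠ 0) (hy : ∀ i ∈ s, α i y ≠ 0)
    (hne : ∃ i ∈ s, SignType.sign (α i x) ≠ SignType.sign (α i y)) :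
    ∃ z, ∃ i ∈ s, SignType.sign (α i x) ≠ SignType.sign (α i y) ∧
      SignType.sign (α i z) = SignType.sign (α i y) ∧
      ∀ j ∈ s, j ≠ i → SignType.sign (α j z) = SignType.sign (α j x) := by
  -- move `x` so that no two hyperplanes are crossed simultaneously
  obtain ⟨x', hx', hgen⟩ : ∃ x', (∀ i ∈ s, SignType.sign (α i x') = SignType.sign (α i x)) ∧
      ∀ i ∈ s, ∀ j ∈ s, i ≠ j → α i x' * α j y ≠ α j x' * α i y := by
    -- `β (i, j)` vanishes at `x'` exactly when `hgen` fails for `i` and `j`, that is, when their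
    -- crossing parameters would coincide.
    let β : ι × ι → Module.Dual ℝ V := fun p => α p.2 y • α p.1 - α p.1 y • α p.2
    have hβ : ∀ i ∈ s, ∀ j ∈ s, i ≠ j → β (i, j) ≠ 0 := by
      intro i hi j hj hij h0
      refine hij (hα i hi j hj ?_)
      have h0 : α j y • α i = α i y • α j := sub_eq_zero.1 h0
      rw [← LinearMap.ker_smul (α i) _ (hy j hj), h0, LinearMap.ker_smul _ _ (hy i hi)]
    obtain ⟨v, hv⟩ := exists_forall_apply_ne_zero (s.offDiag.image β) (by
      intro γ hγ
      obtain ⟨⟨i, j⟩, hp, rfl⟩ := Finset.mem_image.1 hγ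
      rw [Finset.mem_offDiag] at hp
      exact hβ i hp.1 j hp.2.1 hp.2.2)
    -- Indexing the forms by themselves lets one small move keep the signs of all `α i` and make all
    -- `β (i, j)` nonzero.
    obtain ⟨x', h⟩ := exists_sgn_compose (id : Module.Dual ℝ V → _)
      (s.image α ∪ s.offDiag.image β) x v
    simp only [id_eq] at h
    refine ⟨x', fun i hi => ?_, fun i hi j hj hij heq => ?_⟩
    · rw [h _ (Finset.mem_union_left _ (Finset.mem_image_of_mem α hi)), if_neg (hx i hi)]
    · have hmem : β (i, j) ∈ s.offDiag.image β :=
        Finset.mem_image_of_mem β (Finset.mem_offDiag.2 ⟨hi, hj, hij⟩)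
      have h1 := h _ (Finset.mem_union_right _ hmem)
      have h2 : β (i, j) x' = 0 := by
        simp only [β, LinearMap.sub_apply, LinearMap.smul_apply, smul_eq_mul]
        linarith
      rw [h2, sign_zero] at h1
      split_ifs at h1 with h0
      · exact hv _ hmem (sign_eq_zero_iff.1 h1.symm)
      · exact h0 (sign_eq_zero_iff.1 h1.symm)
  have hx0 : ∀ i ∈ s, α i x' ≠ 0 := fun i hi => by
    rw [← sign_ne_zero, hx' i hi, sign_ne_zero]
    exact hx i hi
  -- the first hyperplane crossed by the segment from `x'` to `y`
  let T := s.filter fun i => SignType.sign (α i x) ≠ SignType.sign (α i y)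
  -- The parameter at which the segment meets the kernel of `α i`; used only for indices in `T`,
  -- where the denominator is nonzero.
  let τ : ι → ℝ := fun i => α i x' / (α i x' - α i y)
  have hT : T.Nonempty := by
    obtain ⟨i, hi, h⟩ := hne
    exact ⟨i, Finset.mem_filter.2 ⟨hi, h⟩⟩
  obtain ⟨i, hiT, hmin⟩ := T.exists_min_image τ hT
  have hTs : ∀ j ∈ T, (0 < α j x' ∧ α j y < 0) ∨ (α j x' < 0 ∧ 0 < α j y) := by
    intro j hj
    obtain ⟨hjs, hj⟩ := Finset.mem_filter.1 hj
    rw [← hx' j hjs] at hj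
    rcases lt_or_gt_of_ne (hx0 j hjs) with h | h <;> rcases lt_or_gt_of_ne (hy j hjs) with h' | h'
    · simp [sign_neg h, sign_neg h'] at hj
    · exact Or.inr ⟨h, h'⟩
    · exact Or.inl ⟨h, h'⟩
    · simp [sign_pos h, sign_pos h'] at hj
  have hden : ∀ j ∈ T, α j x' - α j y ≠ 0 := by
    intro j hj
    rcases hTs j hj with h | h
    · exact (by linarith [h.1, h.2] : 0 < α j x' - α j y).ne'
    · exact (by linarith [h.1, h.2] : α j x' - α j y < 0).ne
  have hi01 : 0 < τ i ∧ τ i < 1 := by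
    rcases hTs i hiT with h | h
    · have : 0 < α i x' - α i y := by linarith [h.1, h.2]
      exact ⟨div_pos h.1 this, (div_lt_one this).2 (by linarith [h.2])⟩
    · have : α i x' - α i y < 0 := by linarith [h.1, h.2]
      exact ⟨div_pos_of_neg_of_neg h.1 this, (div_lt_one_of_neg this).2 (by linarith [h.2])⟩
  have his := (Finset.mem_filter.1 hiT).1
  let z₀ := x' + τ i • (y - x')
  have hz₀ : ∀ j, α j z₀ = α j x' - τ i * (α j x' - α j y) := fun j => by
    simp only [z₀, map_add, map_smul, map_sub, smul_eq_mul]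
    ring
  have hz₀i : α i z₀ = 0 := by
    rw [hz₀, div_mul_cancel₀ _ (hden i hiT), sub_self]
  have hz₀j : ∀ j ∈ s, j ≠ i → SignType.sign (α j z₀) = SignType.sign (α j x) := by
    intro j hj hji
    rw [← hx' j hj, hz₀]
    by_cases hjT : j ∈ T
    · have hlt : τ i < τ j := by
        refine lt_of_le_of_ne (hmin j hjT) fun heq => hgen i his j hj hji.symm ?_
        rw [div_eq_div_iff (hden i hiT) (hden j hjT)] at heq
        linarith
      have hfac : α j x' - τ i * (α j x' - α j y) = (τ j - τ i) * (α j x' - α j y) := by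
        rw [sub_mul, div_mul_cancel₀ _ (hden j hjT)]
      rw [hfac, sign_mul, sign_pos (sub_pos.2 hlt), one_mul]
      rcases hTs j hjT with h | h
      · rw [sign_pos h.1, sign_pos (by linarith [h.1, h.2])]
      · rw [sign_neg h.1, sign_neg (by linarith [h.1, h.2])]
    · have hsame : SignType.sign (α j x') = SignType.sign (α j y) := by
        rw [hx' j hj]
        by_contra h
        exact hjT (Finset.mem_filter.2 ⟨hj, h⟩)
      rcases lt_or_gt_of_ne (hx0 j hj) with h | h
      · rw [sign_neg h, eq_comm, sign_eq_neg_one_iff] at hsame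
        rw [sign_neg h, sign_eq_neg_one_iff]
        nlinarith [mul_pos hi01.1 (neg_pos.2 hsame), mul_pos (sub_pos.2 hi01.2) (neg_pos.2 h)]
      · rw [sign_pos h, eq_comm, sign_eq_one_iff] at hsame
        rw [sign_pos h, sign_eq_one_iff]
        nlinarith [mul_pos hi01.1 hsame, mul_pos (sub_pos.2 hi01.2) h]
  -- At the crossing point only `α i` vanishes, so a small move towards the signs of `y` changes
  -- that sign alone.
  obtain ⟨z, hz⟩ := exists_sgn_compose α s z₀ y
  refine ⟨z, i, his, (Finset.mem_filter.1 hiT).2, ?_, fun j hj hji => ?_⟩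
  · rw [hz i his, if_pos hz₀i]
  · have h0 : α j z₀ ≠ 0 := by
      rw [← sign_ne_zero, hz₀j j hj hji, sign_ne_zero]
      exact hx j hj
    rw [hz j hj, if_neg h0, hz₀j j hj hji]

end Segment

end LinearForms

/-! ### Graph distance, magnitude from a weighting, and substitution of `q⁻¹` -/

/-- Iterating `hstep` gives a walk of length `δ x y`; the triangle inequality along any walk shows
that none is shorter. -/
theorem SimpleGraph.reachable_and_dist_eq {V : Type*} (G : SimpleGraph V) (δ : V → V → ℕ)
    (hadj : ∀ x y, G.Adj x y → δ x y ≤ 1) (h0 : ∀ x, δ x x = 0)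
    (htri : ∀ x y z, δ x z ≤ δ x y + δ y z)
    (hstep : ∀ x y, x ≠ y → ∃ z, G.Adj x z ∧ δ z y + 1 = δ x y) (x y : V) :
    G.Reachable x y ∧ G.dist x y = δ x y := by
  have hwalk : ∀ n x, δ x y = n → ∃ p : G.Walk x y, p.length = n := by
    intro n
    induction n with
    | zero =>
      intro x hx
      by_cases h : x = y
      · subst h; exact ⟨.nil, rfl⟩
      · obtain ⟨z, -, hz⟩ := hstep x y h
        omega
    | succ n ih =>
      intro x hx
      have h : x ≠ y := by rintro rfl; simp [h0] at hx
      obtain ⟨z, hxz, hz⟩ := hstep x y h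
      obtain ⟨p, hp⟩ := ih z (by omega)
      exact ⟨.cons hxz p, by simp [hp]⟩
  have hle : ∀ {x y : V} (p : G.Walk x y), δ x y ≤ p.length := by
    intro x y p
    induction p with
    | nil => simp [h0]
    | @cons u v w h p ih =>
      have h1 := htri u v w
      have h2 := hadj u v h
      rw [SimpleGraph.Walk.length_cons]
      omega
  obtain ⟨p, hp⟩ := hwalk _ x rfl
  obtain ⟨p', hp'⟩ := p.reachable.exists_walk_length_eq_dist
  exact ⟨p.reachable, le_antisymm (hp ▸ SimpleGraph.dist_le p) (hp' ▸ hle p')⟩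

theorem SimpleGraph.magnitude_eq_sum {V : Type*} [Fintype V] (G : SimpleGraph V)
    {w : V → RatFunc ℚ} (hw : ∀ x, ∑ y, G.zetaMatrix x y * w y = 1) : G.magnitude = ∑ x, w x := by
  classical
  have h : G.zetaMatrix.mulVec w = fun _ => 1 := funext hw
  have hu := G.isUnit_det_zetaMatrix
  rw [SimpleGraph.magnitude]
  refine Finset.sum_congr rfl fun x _ => ?_
  have h2 : (G.zetaMatrix)⁻¹.mulVec (G.zetaMatrix.mulVec w) = w := by
    rw [Matrix.mulVec_mulVec, Matrix.nonsing_inv_mul _ (by convert hu), Matrix.one_mulVec]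
  rw [h] at h2
  have h3 := congrFun h2 x
  simp only [Matrix.mulVec, dotProduct, mul_one] at h3
  convert h3

theorem SimpleGraph.exists_weighting {V : Type*} [Fintype V] (G : SimpleGraph V) :
    ∃ w : V → RatFunc ℚ, ∀ x, ∑ y, G.zetaMatrix x y * w y = 1 := by
  classical
  refine ⟨(G.zetaMatrix)⁻¹.mulVec fun _ => 1, fun x => ?_⟩
  have h : G.zetaMatrix.mulVec ((G.zetaMatrix)⁻¹.mulVec fun _ => 1) = fun _ => 1 := by
    rw [Matrix.mulVec_mulVec, Matrix.mul_nonsing_inv _ (by convert G.isUnit_det_zetaMatrix),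
      Matrix.one_mulVec]
  exact congrFun h x

/-- A zero of `p` at `q⁻¹` would be a zero of the reversed polynomial at the indeterminate `q`.
Hence denominators survive the substitution, which becomes a ring homomorphism. -/
theorem RatFunc.eval₂_inv_X_ne_zero {p : Polynomial ℚ} (hp : p ≠ 0) :
    Polynomial.eval₂ (RatFunc.C : ℚ →+* RatFunc ℚ) (RatFunc.X)⁻¹ p ≠ 0 := by
  let _ : Invertible (RatFunc.X⁻¹ : RatFunc ℚ) := invertibleOfNonzero (inv_ne_zero RatFunc.X_ne_zero)
  intro h
  rw [← Polynomial.eval₂_reverse_eq_zero_iff, invOf_eq_inv, inv_inv] at h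
  have : Polynomial.eval₂ (RatFunc.C : ℚ →+* RatFunc ℚ) RatFunc.X p.reverse =
      algebraMap (Polynomial ℚ) (RatFunc ℚ) p.reverse := by
    have h1 : Polynomial.eval₂RingHom (RatFunc.C : ℚ →+* RatFunc ℚ) RatFunc.X =
        algebraMap (Polynomial ℚ) (RatFunc ℚ) := by
      apply Polynomial.ringHom_ext <;> simp
    exact RingHom.congr_fun h1 p.reverse
  rw [this] at h
  simp [hp] at h

theorem RatFunc.nonZeroDivisors_le_comap_eval₂_inv_X : nonZeroDivisors (Polynomial ℚ) ≤
    (nonZeroDivisors (RatFunc ℚ)).comap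
      (Polynomial.eval₂RingHom (RatFunc.C : ℚ →+* RatFunc ℚ) RatFunc.X⁻¹) := fun _ hp =>
  mem_nonZeroDivisors_of_ne_zero (RatFunc.eval₂_inv_X_ne_zero (nonZeroDivisors.ne_zero hp))

/-- The substitution of `q⁻¹` for `q` in `ℚ(q)`. -/
noncomputable def RatFunc.invSubst : RatFunc ℚ →+* RatFunc ℚ :=
  RatFunc.liftRingHom (Polynomial.eval₂RingHom RatFunc.C RatFunc.X⁻¹)
    RatFunc.nonZeroDivisors_le_comap_eval₂_inv_X

theorem RatFunc.invSubst_apply (f : RatFunc ℚ) :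
    RatFunc.invSubst f = RatFunc.eval RatFunc.C (RatFunc.X : RatFunc ℚ)⁻¹ f := by
  rw [RatFunc.invSubst, RatFunc.liftRingHom_apply, RatFunc.eval]
  rfl

theorem RatFunc.invSubst_X : RatFunc.invSubst RatFunc.X = RatFunc.X⁻¹ := by
  rw [RatFunc.invSubst_apply, RatFunc.eval_X]

/-! ### Faces and chambers as sign vectors -/

namespace CentralArrangement

open LinearForms

open scoped Classical

section Faces

variable {V : Type*} [AddCommGroup V] [Module ℝ V]

/-- A form defining the hyperplane `H`. -/
noncomputable def form (H : Submodule ℝ V) : Module.Dual ℝ V :=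
  if h : Module.finrank ℝ (V ⧸ H) = 1 then (exists_form h).choose else 0

variable (A : CentralArrangement V)

theorem ker_form {H : Submodule ℝ V} (hH : H ∈ A.hyperplanes) : LinearMap.ker (form H) = H := by
  rw [form, dif_pos (A.codim_one H hH)]
  exact (exists_form (A.codim_one H hH)).choose_spec

theorem form_eq_zero_iff {H : Submodule ℝ V} (hH : H ∈ A.hyperplanes) {x : V} :
    form H x = 0 ↔ x ∈ H := by
  rw [← LinearMap.mem_ker, A.ker_form hH]

theorem mem_stratum_iff {x y : V} :
    y ∈ A.stratum x ↔ sgn form A.hyperplanes y = sgn form A.hyperplanes x := by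
  rw [sgn_eq_iff]
  refine ⟨fun h H hH => h H hH _ (A.ker_form hH), fun h H hH β hβ => ?_⟩
  obtain ⟨c, rfl⟩ := exists_eq_smul ((A.ker_form hH).trans hβ.symm)
  simp [sign_mul, h H hH]

theorem self_mem_stratum (x : V) : x ∈ A.stratum x := A.mem_stratum_iff.2 rfl

theorem stratum_eq_iff {x y : V} :
    A.stratum x = A.stratum y ↔ sgn form A.hyperplanes x = sgn form A.hyperplanes y := by
  refine ⟨fun h => A.mem_stratum_iff.1 (h ▸ A.self_mem_stratum x), fun h => ?_⟩
  ext z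
  rw [mem_stratum_iff, mem_stratum_iff, h]

theorem localization_stratum (x : V) : (A.localization (A.stratum x)).hyperplanes =
    zeros A.hyperplanes (sgn form A.hyperplanes x) := by
  ext H
  rw [mem_zeros_sgn]
  simp only [localization, Finset.mem_filter]
  refine and_congr_right fun hH => ⟨fun h => ?_, fun h y hy => ?_⟩
  · exact (A.form_eq_zero_iff hH).2 (h (A.self_mem_stratum x))
  · have := sgn_eq_iff.1 (A.mem_stratum_iff.1 hy) H hH
    rw [h, sign_zero, sign_eq_zero_iff] at this
    exact (A.form_eq_zero_iff hH).1 this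

theorem rank_eq : A.rank = codimKer form A.hyperplanes := by
  have : (⨅ H ∈ A.hyperplanes, H) = ⨅ H ∈ A.hyperplanes, LinearMap.ker (form H) :=
    iInf_congr fun H => iInf_congr fun hH => (A.ker_form hH).symm
  rw [rank, this, codimKer]

/-- The span of a face is the intersection of the hyperplanes containing it: for `v` in that
intersection, `x + ε v` stays in the face for small `ε`, so `v` is a multiple of a difference of two
of its points. -/
theorem codim_stratum (x : V) : codim (A.stratum x) = (A.localization (A.stratum x)).rank := by
  have : Submodule.span ℝ (A.stratum x) = ⨅ H ∈ (A.localization (A.stratum x)).hyperplanes, H := by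
    refine le_antisymm (Submodule.span_le.2 fun y hy => ?_) fun v hv => ?_
    · simp only [SetLike.mem_coe, Submodule.mem_iInf]
      intro H hH
      simp only [localization, Finset.mem_filter] at hH
      exact hH.2 hy
    · obtain ⟨y, hy⟩ : ∃ ε : ℝ, ε ≠ 0 ∧ x + ε • v ∈ A.stratum x := by
        have h : ∀ᶠ ε in nhdsWithin (0 : ℝ) (Set.Ioi 0), 0 < ε ∧ ∀ H ∈ A.hyperplanes,
            SignType.sign (form H x + ε * form H v) =
              if form H x = 0 then SignType.sign (form H v) else SignType.sign (form H x) :=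
          Filter.Eventually.and self_mem_nhdsWithin
            ((Filter.eventually_all_finset _).2 fun _ _ => eventually_sign_add_mul _ _)
        obtain ⟨ε, hε, h⟩ := h.exists
        refine ⟨ε, hε.ne', ?_⟩
        rw [mem_stratum_iff, sgn_eq_iff]
        intro H hH
        rw [map_add, map_smul, smul_eq_mul, h H hH]
        split_ifs with h0
        · have hmem : H ∈ (A.localization (A.stratum x)).hyperplanes := by
            rw [localization_stratum]
            exact mem_zeros_sgn.2 ⟨hH, h0⟩
          simp only [Submodule.mem_iInf] at hv
          rw [h0, (A.form_eq_zero_iff hH).2 (hv H hmem)]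
        · rfl
      have h1 := Submodule.subset_span (R := ℝ) hy.2
      have h2 := Submodule.subset_span (R := ℝ) (A.self_mem_stratum x)
      have h3 := Submodule.sub_mem _ h1 h2
      rwa [add_sub_cancel_left, Submodule.smul_mem_iff _ hy.1] at h3
  rw [codim, this, rank]

/-- Codimension and magnitude of a localization depend only on its hyperplanes, so functions of that
set suffice. -/
theorem sum_faces {K : Type*} [AddCommMonoid K] (f : Finset (Submodule ℝ V) → K) :
    ∑ F : A.faces, f (A.localization F).hyperplanes =
      ∑ X ∈ covectors form A.hyperplanes, f (zeros A.hyperplanes X) := by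
  choose p hp using fun F : A.faces => F.2
  refine Finset.sum_nbij (fun F => sgn form A.hyperplanes (p F)) ?_ ?_ ?_ ?_
  · exact fun F _ => mem_covectors.2 ⟨_, rfl⟩
  · intro F _ G _ h
    have := A.stratum_eq_iff.2 h
    rw [hp, hp] at this
    exact Subtype.ext this
  · intro X hX
    obtain ⟨x, rfl⟩ := mem_covectors.1 hX
    refine ⟨⟨A.stratum x, x, rfl⟩, Finset.mem_coe.2 (Finset.mem_univ _), ?_⟩
    exact A.stratum_eq_iff.1 (hp _)
  · intro F _
    rw [← localization_stratum, hp]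

end Faces

section Chambers

variable {V : Type*} [NormedAddCommGroup V] [NormedSpace ℝ V] (A : CentralArrangement V)

theorem mem_complement_iff {x : V} :
    x ∈ A.complement ↔ ∀ H ∈ A.hyperplanes, form H x ≠ 0 :=
  forall₂_congr fun _ hH => not_congr (A.form_eq_zero_iff hH).symm

theorem stratum_subset_component {x : V} (hx : x ∈ A.complement) :
    A.stratum x ⊆ connectedComponentIn A.complement x := by
  refine (A.convex_stratum x).isPreconnected.subset_connectedComponentIn (A.self_mem_stratum x) ?_
  intro y hy
  rw [mem_complement_iff] at hx ⊢
  intro H hH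
  rw [← sign_ne_zero, sgn_eq_iff.1 (A.mem_stratum_iff.1 hy) H hH, sign_ne_zero]
  exact hx H hH

/-- The image of a component under a defining form is an interval of `ℝ` avoiding 0, so the sign is
constant; conversely strata are convex. -/
theorem component_eq_stratum [FiniteDimensional ℝ V] {x : V} (hx : x ∈ A.complement) :
    connectedComponentIn A.complement x = A.stratum x := by
  refine Set.Subset.antisymm (fun y hy => ?_) (A.stratum_subset_component hx)
  rw [mem_stratum_iff, sgn_eq_iff]
  intro H hH
  have hsub := connectedComponentIn_subset A.complement x
  have h0 : ∀ z ∈ connectedComponentIn A.complement x, form H z ≠ 0 := fun z hz =>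
    A.mem_complement_iff.1 (hsub hz) H hH
  have hpre := (isPreconnected_connectedComponentIn (F := A.complement) (x := x)).image (form H)
    (LinearMap.continuous_of_finiteDimensional _).continuousOn
  have hxm := mem_connectedComponentIn hx
  have hno : (0 : ℝ) ∉ form H '' connectedComponentIn A.complement x := by
    rintro ⟨z, hz, hz0⟩
    exact h0 z hz hz0
  have hord := hpre.ordConnected
  rcases lt_or_gt_of_ne (h0 x hxm) with h | h <;> rcases lt_or_gt_of_ne (h0 y hy) with h' | h'
  · rw [sign_neg h, sign_neg h']
  · exact absurd (hord.out ⟨x, hxm, rfl⟩ ⟨y, hy, rfl⟩ ⟨h.le, h'.le⟩) hno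
  · exact absurd (hord.out ⟨y, hy, rfl⟩ ⟨x, hxm, rfl⟩ ⟨h'.le, h.le⟩) hno
  · rw [sign_pos h, sign_pos h']

variable [FiniteDimensional ℝ V]

theorem exists_chamber_eq_stratum (C : A.chambers) :
    ∃ x, x ∈ A.complement ∧ A.stratum x = (C : Set V) := by
  obtain ⟨x, hx, h⟩ := C.2
  exact ⟨x, hx, by rw [← h, A.component_eq_stratum hx]⟩

/-- A point of the chamber `C`. -/
noncomputable def chamberPoint (C : A.chambers) : V := (A.exists_chamber_eq_stratum C).choose

theorem chamberPoint_mem_complement (C : A.chambers) : A.chamberPoint C ∈ A.complement :=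
  (A.exists_chamber_eq_stratum C).choose_spec.1

theorem stratum_chamberPoint (C : A.chambers) : A.stratum (A.chamberPoint C) = C :=
  (A.exists_chamber_eq_stratum C).choose_spec.2

/-- The sign vector of a chamber. -/
noncomputable def tope (C : A.chambers) : Submodule ℝ V → SignType :=
  sgn form A.hyperplanes (A.chamberPoint C)

theorem tope_injective : Function.Injective A.tope := fun C D h => by
  have := A.stratum_eq_iff.2 h
  rw [stratum_chamberPoint, stratum_chamberPoint] at this
  exact Subtype.ext this

theorem tope_mem (C : A.chambers) : A.tope C ∈ topes form A.hyperplanes := by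
  refine mem_topes.2 ⟨⟨_, rfl⟩, fun H hH => ?_⟩
  rw [tope, sgn_of_mem hH, sign_ne_zero]
  exact A.mem_complement_iff.1 (A.chamberPoint_mem_complement C) H hH

theorem exists_tope_eq {x : V} (hx : x ∈ A.complement) :
    ∃ C, A.tope C = sgn form A.hyperplanes x := by
  refine ⟨⟨A.stratum x, x, hx, A.component_eq_stratum hx⟩, ?_⟩
  exact A.stratum_eq_iff.1 (A.stratum_chamberPoint _)

theorem exists_tope_eq_of_mem {X : Submodule ℝ V → SignType}
    (hX : X ∈ topes form A.hyperplanes) : ∃ C, A.tope C = X := by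
  obtain ⟨⟨x, rfl⟩, hx⟩ := mem_topes.1 hX
  refine A.exists_tope_eq (A.mem_complement_iff.2 fun H hH => ?_)
  simpa [sgn_of_mem hH, sign_eq_zero_iff] using hx H hH

theorem sum_chambers {K : Type*} [AddCommMonoid K] (f : (Submodule ℝ V → SignType) → K) :
    ∑ C : A.chambers, f (A.tope C) = ∑ X ∈ topes form A.hyperplanes, f X := by
  refine Finset.sum_nbij A.tope (fun C _ => A.tope_mem C) A.tope_injective.injOn ?_ fun _ _ => rfl
  intro X hX
  obtain ⟨C, hC⟩ := A.exists_tope_eq_of_mem hX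
  exact ⟨C, Finset.mem_coe.2 (Finset.mem_univ _), hC⟩

theorem sign_form_of_mem {C : A.chambers} {x : V} (hx : x ∈ (C : Set V)) {H : Submodule ℝ V}
    (hH : H ∈ A.hyperplanes) : SignType.sign (form H x) = A.tope C H := by
  rw [← stratum_chamberPoint, mem_stratum_iff] at hx
  rw [tope, ← hx, sgn_of_mem hH]

theorem chamberPoint_mem (C : A.chambers) : A.chamberPoint C ∈ (C : Set V) := by
  have := A.self_mem_stratum (A.chamberPoint C)
  rwa [stratum_chamberPoint] at this

theorem separates_iff {C D : A.chambers} {H : Submodule ℝ V} (hH : H ∈ A.hyperplanes) :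
    Separates H (C : Set V) D ↔ A.tope C H ≠ A.tope D H := by
  constructor
  · rintro ⟨β, hβ, hC, hD⟩ h
    obtain ⟨c, rfl⟩ := exists_eq_smul ((A.ker_form hH).trans hβ.symm)
    have h1 := hC _ (A.chamberPoint_mem C)
    have h2 := hD _ (A.chamberPoint_mem D)
    rw [← sign_eq_one_iff, LinearMap.smul_apply, smul_eq_mul, sign_mul,
      A.sign_form_of_mem (A.chamberPoint_mem C) hH] at h1
    rw [← sign_eq_neg_one_iff, LinearMap.smul_apply, smul_eq_mul, sign_mul,
      A.sign_form_of_mem (A.chamberPoint_mem D) hH, ← h, h1] at h2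
    exact absurd h2 (by decide)
  · intro h
    have hC := (mem_topes.1 (A.tope_mem C)).2 H hH
    have hD := (mem_topes.1 (A.tope_mem D)).2 H hH
    have hcase : (A.tope C H = 1 ∧ A.tope D H = -1) ∨ (A.tope C H = -1 ∧ A.tope D H = 1) := by
      revert h hC hD
      generalize A.tope C H = a
      generalize A.tope D H = b
      revert a b
      decide
    rcases hcase with ⟨h1, h2⟩ | ⟨h1, h2⟩
    · refine ⟨form H, A.ker_form hH, fun x hx => ?_, fun y hy => ?_⟩
      · rw [← sign_eq_one_iff, A.sign_form_of_mem hx hH, h1]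
      · rw [← sign_eq_neg_one_iff, A.sign_form_of_mem hy hH, h2]
    · refine ⟨-form H, by ext; simp [A.form_eq_zero_iff hH], fun x hx => ?_, fun y hy => ?_⟩
      · rw [LinearMap.neg_apply, neg_pos, ← sign_eq_neg_one_iff, A.sign_form_of_mem hx hH, h1]
      · rw [LinearMap.neg_apply, neg_lt_zero, ← sign_eq_one_iff, A.sign_form_of_mem hy hH, h2]

theorem card_separating (C D : A.chambers) :
    (A.separating C D).card = signDist A.hyperplanes (A.tope C) (A.tope D) := by
  rw [separating, signDist]
  exact congrArg _ (Finset.filter_congr fun H hH => A.separates_iff hH)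

theorem topeGraph_adj {C D : A.chambers} :
    A.topeGraph.Adj C D ↔ signDist A.hyperplanes (A.tope C) (A.tope D) = 1 := by
  rw [← card_separating]
  rfl

theorem signDist_triangle {ι : Type*} (s : Finset ι) (X Y Z : ι → SignType) :
    signDist s X Z ≤ signDist s X Y + signDist s Y Z := by
  refine le_trans (Finset.card_le_card ?_) (Finset.card_union_le _ _)
  intro i
  simp only [Finset.mem_union, Finset.mem_filter]
  rintro ⟨hi, h⟩
  by_cases hXY : X i = Y i
  · exact Or.inr ⟨hi, hXY ▸ h⟩
  · exact Or.inl ⟨hi, hXY⟩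

/-- The distance in the tope graph is the number of separating hyperplanes. -/
theorem topeGraph_reachable_and_dist (C D : A.chambers) : A.topeGraph.Reachable C D ∧
    A.topeGraph.dist C D = signDist A.hyperplanes (A.tope C) (A.tope D) := by
  refine SimpleGraph.reachable_and_dist_eq _
    (fun C D => signDist A.hyperplanes (A.tope C) (A.tope D))
    (fun C D h => (A.topeGraph_adj.1 h).le) (fun C => by simp [signDist])
    (fun _ _ _ => signDist_triangle _ _ _ _) (fun C D hCD => ?_) C D
  have hC := A.mem_complement_iff.1 (A.chamberPoint_mem_complement C)
  have hD := A.mem_complement_iff.1 (A.chamberPoint_mem_complement D)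
  obtain ⟨z, H, hH, hne, hzH, hz⟩ := exists_neighbour (α := form) (s := A.hyperplanes)
    (fun H hH K hK h => by rwa [A.ker_form hH, A.ker_form hK] at h) hC hD (by
      by_contra! h
      exact hCD (A.tope_injective (sgn_eq_iff.2 h)))
  obtain ⟨E, hE⟩ := A.exists_tope_eq (x := z) (A.mem_complement_iff.2 fun K hK => by
    rw [← sign_ne_zero]
    by_cases hKH : K = H
    · subst hKH
      rw [hzH, sign_ne_zero]
      exact hD K hK
    · rw [hz K hK hKH, sign_ne_zero]
      exact hC K hK)
  have hEH : A.tope E H = A.tope D H := by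
    rw [hE, tope, sgn_of_mem hH, sgn_of_mem hH, hzH]
  have hEK : ∀ K ∈ A.hyperplanes, K ≠ H → A.tope E K = A.tope C K := fun K hK hKH => by
    rw [hE, tope, sgn_of_mem hK, sgn_of_mem hK, hz K hK hKH]
  have hCDH : A.tope C H ≠ A.tope D H := by
    rwa [tope, tope, sgn_of_mem hH, sgn_of_mem hH]
  refine ⟨E, A.topeGraph_adj.2 ?_, ?_⟩
  · rw [signDist, Finset.card_eq_one]
    refine ⟨H, ?_⟩
    ext K
    rw [Finset.mem_filter, Finset.mem_singleton]
    constructor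
    · rintro ⟨hK, h⟩
      by_contra hKH
      exact h (hEK K hK hKH).symm
    · rintro rfl
      exact ⟨hH, hEH ▸ hCDH⟩
  · have hins : (A.hyperplanes.filter fun K => A.tope C K ≠ A.tope D K) =
        insert H (A.hyperplanes.filter fun K => A.tope E K ≠ A.tope D K) := by
      ext K
      rw [Finset.mem_insert, Finset.mem_filter, Finset.mem_filter]
      by_cases hKH : K = H
      · subst hKH
        simp [hH, hCDH]
      · simp only [hKH, false_or]
        exact and_congr_right fun hK => by rw [hEK K hK hKH]
    rw [signDist, signDist, hins, Finset.card_insert_of_notMem (by simp [hEH])]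

theorem zetaMatrix_topeGraph (C D : A.chambers) : A.topeGraph.zetaMatrix C D =
    RatFunc.X ^ signDist A.hyperplanes (A.tope C) (A.tope D) := by
  obtain ⟨h1, h2⟩ := A.topeGraph_reachable_and_dist C D
  rw [SimpleGraph.zetaMatrix, Matrix.of_apply, if_pos h1, h2]

theorem mag_eq_sum {w : (Submodule ℝ V → SignType) → RatFunc ℚ}
    (hw : IsWeighting RatFunc.X form A.hyperplanes w) :
    A.mag = ∑ X ∈ topes form A.hyperplanes, w X := by
  rw [mag, A.topeGraph.magnitude_eq_sum (w := fun C => w (A.tope C)), sum_chambers]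
  intro C
  rw [← hw _ (A.tope_mem C), ← sum_chambers]
  simp only [zetaMatrix_topeGraph]

theorem exists_isWeighting : ∃ w : (Submodule ℝ V → SignType) → RatFunc ℚ,
    IsWeighting RatFunc.X form A.hyperplanes w := by
  obtain ⟨w, hw⟩ := A.topeGraph.exists_weighting
  -- The value 0 off the topes is immaterial, since weightings are only summed over topes.
  refine ⟨Function.extend A.tope w 0, fun X hX => ?_⟩
  obtain ⟨C, rfl⟩ := A.exists_tope_eq_of_mem hX
  rw [← hw C, ← sum_chambers]
  simp only [zetaMatrix_topeGraph, A.tope_injective.extend_apply]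

/-- Substituting `q⁻¹` in a weighting and then applying `IsWeighting.inv` gives another weighting
for `q`; both have total `A.mag`. -/
theorem interiorMag_eq :
    A.interiorMag = (-1) ^ A.rank * RatFunc.X ^ A.hyperplanes.card * A.mag := by
  obtain ⟨w, hw⟩ := A.exists_isWeighting
  have h := (hw.map RatFunc.invSubst).inv (by
    rw [RatFunc.invSubst_X]
    exact inv_ne_zero RatFunc.X_ne_zero)
  rw [RatFunc.invSubst_X, inv_inv] at h
  have h1 := A.mag_eq_sum h
  rw [← Finset.mul_sum, sum_neg_topes fun C => RatFunc.invSubst (w C), ← map_sum,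
    ← A.mag_eq_sum hw] at h1
  rw [interiorMag, ← RatFunc.invSubst_apply, mul_assoc]
  congr 1
  conv_rhs => rw [h1]
  rw [← mul_assoc, ← mul_pow, mul_inv_cancel₀ RatFunc.X_ne_zero, one_pow, one_mul]

/-- No recursion is involved: the smallest face contributes a weighting of `A` itself, and
`facewise` is compared with it only through its total. -/
theorem mag_eq_sum_faces : A.mag = ∑ F : A.faces, (-1) ^ codim (F : Set V) *
    RatFunc.X ^ (A.localization F).hyperplanes.card * (A.localization F).mag := by
  choose w hw using fun B : CentralArrangement V => B.exists_isWeighting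
  -- Intersecting with `A.hyperplanes` makes every finite set an arrangement; the sets that occur
  -- are already contained in it.
  let sub (t : Finset (Submodule ℝ V)) : CentralArrangement V :=
    ⟨A.hyperplanes ∩ t, fun H hH => A.codim_one H (Finset.mem_inter.1 hH).1⟩
  have hsub : ∀ B : CentralArrangement V, B.hyperplanes ⊆ A.hyperplanes →
      sub B.hyperplanes = B := by
    rintro ⟨t, ht⟩ h
    simp only [sub, CentralArrangement.mk.injEq]
    exact Finset.inter_eq_right.2 h
  have hsub' : ∀ X, (sub (zeros A.hyperplanes X)).hyperplanes = zeros A.hyperplanes X :=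
    fun X => Finset.inter_eq_right.2 (zeros_subset X)
  have hwt := isWeighting_facewise (α := form) (s := A.hyperplanes) (RatFunc.X : RatFunc ℚ)
    (fun t => w (sub t)) (fun X _ => by
      have := hw (sub (zeros A.hyperplanes X))
      rwa [hsub'] at this)
  rw [A.mag_eq_sum hwt, sum_facewise]
  have hmag : ∀ X, ∑ C ∈ topes form (zeros A.hyperplanes X), w (sub (zeros A.hyperplanes X)) C =
      (sub (zeros A.hyperplanes X)).mag := fun X => by
    rw [mag_eq_sum _ (hw _), hsub']
  simp only [hmag]
  rw [← A.sum_faces fun t => (-1) ^ codimKer form t * RatFunc.X ^ t.card * (sub t).mag]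
  refine Finset.sum_congr rfl fun F _ => ?_
  obtain ⟨x, hx⟩ := F.2
  rw [hsub _ (Finset.filter_subset _ _), ← rank_eq, ← hx, codim_stratum]

end Chambers

end CentralArrangement

theorem theorem3 {V : Type*} [NormedAddCommGroup V] [NormedSpace ℝ V] [FiniteDimensional ℝ V]
    (A : CentralArrangement V) :
    A.mag = ∑ F : A.faces, (A.localization F).interiorMag ∧
    A.mag = ∑ F : A.faces, (-1) ^ CentralArrangement.codim (F : Set V) *
      RatFunc.X ^ (A.localization F).hyperplanes.card * (A.localization F).mag := by
  refine ⟨?_, A.mag_eq_sum_faces⟩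
  rw [A.mag_eq_sum_faces]
  refine Finset.sum_congr rfl fun F _ => ?_
  obtain ⟨x, hx⟩ := F.2
  rw [CentralArrangement.interiorMag_eq, ← hx, CentralArrangement.codim_stratum]
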